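/- A sequential game over a non-empty finite set $N$ of players, a non-empty finite set $O$ of outcomes and preferences $(<_i)_{i\in N}$ (binary relations on $O$; $x<_i y$ means that player $i$ prefers $y$ to $x$) is given by a non-empty finite set $A$ of actions, a finite prefix-closed set $H$ of finite sequences over $A$ containing the empty sequence (the nodes; a node $h$ is terminal if $ha\notin H$ for all $a\in A$), an owner in $N$ for each nonterminal node, and an outcome in $O$ for each terminal node. A strategy of player $i$ chooses, at each nonterminal node $h$ owned by $i$, an action $a$ with $ha\in H$; a strategy profile $s=(s_i)_{i\in N}$ consists of one strategy per player. A node lies along the play induced by $s$ if at each of its proper prefixes $s$ chooses its next action; $\langle s\rangle$ denotes the outcome of the unique terminal node lying along the play induced by $s$. A profile $s$ is a strong Nash equilibrium (SNE) if for every non-empty coalition $I\subseteq N$ and all strategies $t_I=(t_i)_{i\in I}$ of its members there is $i\in I$ with $\langle s\rangle\not<_i\langle (s_{-I},t_I)\rangle$. The $\{I,L\}$-dynamics of a game is the relation on profiles in which $s\rightharpoonup s'$ if and only if $s\neq s'$, every player $i$ with $s_i\ne s'_i$ satisfies $\langle s\rangle<_i\langle s'\rangle$ (improvement), and every node at which $s$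 and $s'$ choose different actions lies along the play induced by $s'$ (laziness). It terminates if there is no infinite sequence $(s^k)_{k\in\mathbb N}$ with $s^k\rightharpoonup s^{k+1}$ for all $k$. Write $x\sim_i y$ if neither $x<_i y$ nor $y<_i x$. The preferences are out of pattern if there are no $x,y,z\in O$ and $i,j\in N$ with $x<_i y<_i z$ and $y<_j z<_j x$, and there are no $w,x,y,z\in O$ and $i,j\in N$ with $w<_i x<_i y<_i z$ and $x\sim_j z<_j w\sim_j y$. A strict weak order is an irreflexive transitive relation whose incomparability relation $\sim$ is transitive; a strict linear order is an irreflexive transitive relation in which any two distinct elements are comparable. Let $N$ and $O$ be non-empty finite sets and let $(<_i)_{i\in N}$ be preferences over $O$. Suppose that either $N$ has exactly two elements and every $<_i$ is a strict weak order, or every $<_i$ is a strict linear order. Then the following are equivalent: 1. the $\{I,L\}$-dynamics terminates in every game over $N$, $O$ and $(<_i)_{i\in N}$; 2. every game over $N$, $O$ and $(<_i)_{i\in N}$ admits an SNE; 3. the preferences $(<_i)_{i\in N}$ are out of pattern. -/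

import Mathlib

/-- A sequential (extensive form) game with set of players `N`, set of actions `A` and set of
outcomes `O`: a finite prefix-closed set `H` of finite sequences of actions (the nodes), an owner
for each nonterminal node, an outcome for each terminal node, and a preference relation on the
outcomes for each player (`pref i x y` reads "player `i` prefers `y` to `x`"). -/
structure SeqGame (N A O : Type*) where
  H : Set (List A)
  finite_H : H.Finite
  nil_mem : [] ∈ H
  prefix_closed : ∀ h ∈ H, ∀ h' : List A, h' <+: h → h' ∈ H
  owner : {h : List A // h ∈ H ∧ ∃ a, h ++ [a] ∈ H} → N
  payoff : {h : List A // h ∈ H ∧ ∀ a, h ++ [a] ∉ H} → O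
  pref : N → O → O → Prop

namespace SeqGame

variable {N A O : Type*} (G : SeqGame N A O)

/-- Nonterminal nodes. -/
abbrev Inner : Type _ := {h : List A // h ∈ G.H ∧ ∃ a, h ++ [a] ∈ G.H}

/-- Terminal nodes. -/
abbrev Leaf : Type _ := {h : List A // h ∈ G.H ∧ ∀ a, h ++ [a] ∉ G.H}

/-- The nonterminal nodes belonging to player `i`. -/
abbrev NodesOf (i : N) : Type _ := {h : G.Inner // G.owner h = i}

/-- A strategy of player `i`: a legal action at each node of player `i`. -/
abbrev Strategy (i : N) : Type _ :=
  {σ : G.NodesOf i → A // ∀ h : G.NodesOf i, h.1.1 ++ [σ h] ∈ G.H}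

/-- A strategy profile: one strategy for each player. -/
abbrev Profile : Type _ := ∀ i : N, G.Strategy i

variable {G}

/-- The action `s(h)` that the owner of the nonterminal node `h` plays at `h`. -/
def act (s : G.Profile) (h : G.Inner) : A := (s (G.owner h)).1 ⟨h, rfl⟩

/-- The node `h` lies along the play induced by `s`: at every proper prefix of `h`, the profile
chooses the next action of `h`. -/
def LiesAlong (s : G.Profile) (h : List A) : Prop :=
  ∀ (g : G.Inner) (a : A), g.1 ++ [a] <+: h → act s g = a

theorem act_mem (s : G.Profile) (h : G.Inner) : h.1 ++ [act s h] ∈ G.H :=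
  (s (G.owner h)).2 ⟨h, rfl⟩

theorem LiesAlong.extend {s : G.Profile} {h : G.Inner} (hs : LiesAlong s h.1) :
    LiesAlong s (h.1 ++ [act s h]) := by
  intro g a hga
  rcases List.prefix_concat_iff.mp hga with he | hp
  · obtain ⟨h1, h2⟩ := List.append_inj' he rfl
    obtain rfl : g = h := Subtype.ext h1
    simpa using h2.symm
  · exact hs g a hp

theorem LiesAlong.total {s : G.Profile} {h h' : List A} (hH : h ∈ G.H)
    (hs : LiesAlong s h) (hs' : LiesAlong s h') : h <+: h' ∨ h' <+: h := by
  induction h using List.reverseRecOn with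
  | nil => exact Or.inl List.nil_prefix
  | append_singleton g a ih =>
    have hg : g ∈ G.H := G.prefix_closed _ hH g (List.prefix_append g [a])
    rcases ih hg (fun k b hk => hs k b (hk.trans (List.prefix_append g [a]))) with hp | hp
    · obtain ⟨t, rfl⟩ := hp
      cases t with
      | nil => right; simp
      | cons b t =>
        left
        have h1 := hs ⟨g, hg, a, hH⟩ a List.prefix_rfl
        have h2 := hs' ⟨g, hg, a, hH⟩ b ⟨t, by simp⟩
        obtain rfl : a = b := h1.symm.trans h2
        exact ⟨t, by simp⟩
    · exact Or.inr (hp.trans (List.prefix_append g [a]))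

/-- Exactly one terminal node lies along the play induced by a strategy profile. -/
theorem existsUnique_leaf (s : G.Profile) : ∃! z : G.Leaf, LiesAlong s z.1 := by
  have hfin : {h | h ∈ G.H ∧ LiesAlong s h}.Finite := G.finite_H.subset fun _ h => h.1
  have hne : {h | h ∈ G.H ∧ LiesAlong s h}.Nonempty :=
    ⟨[], G.nil_mem, fun g a hga => by simp at hga⟩
  obtain ⟨h, ⟨hH, hs⟩, hmax⟩ := Set.exists_max_image _ List.length hfin hne
  have hz : ∀ a, h ++ [a] ∉ G.H := by
    intro a ha
    have h1 := hmax (h ++ [act s ⟨h, hH, a, ha⟩])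
      ⟨act_mem s ⟨h, hH, a, ha⟩, LiesAlong.extend (h := ⟨h, hH, a, ha⟩) hs⟩
    simp at h1
  have key : ∀ {u v : List A}, (∀ a, u ++ [a] ∉ G.H) → v ∈ G.H → u <+: v → u = v := by
    rintro u v hu hv ⟨t, rfl⟩
    cases t with
    | nil => simp
    | cons b t => exact absurd (G.prefix_closed _ hv _ ⟨t, by simp⟩) (hu b)
  refine ⟨⟨h, hH, hz⟩, hs, ?_⟩
  rintro ⟨h', hH', hz'⟩ hs'
  apply Subtype.ext
  rcases LiesAlong.total hH hs hs' with hp | hp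
  · exact (key hz hH' hp).symm
  · exact key hz' hH hp

/-- The outcome of a strategy profile: the outcome of the terminal node on its induced play. -/
noncomputable def outcome (s : G.Profile) : O :=
  G.payoff (existsUnique_leaf s).choose

open Classical in
/-- The profile `(s_{-I}, t_I)`: the players of `I` play as in `t`, all others as in `s`. -/
noncomputable def deviate (s : G.Profile) (I : Set N) (t : ∀ i : I, G.Strategy i) : G.Profile :=
  fun i => if h : i ∈ I then t ⟨i, h⟩ else s i

/-- Strong Nash equilibrium: whatever joint deviation a (nonempty) coalition makes, some member
of the coalition does not prefer the new outcome. -/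
def IsSNE (s : G.Profile) : Prop :=
  ∀ I : Set N, I.Nonempty → ∀ t : (∀ i : I, G.Strategy i),
    ∃ i ∈ I, ¬ G.pref i (outcome s) (outcome (deviate s I t))

/-- Improvement property: every player who changes strategy prefers the new outcome. -/
def Improvement (s s' : G.Profile) : Prop :=
  ∀ i : N, s i ≠ s' i → G.pref i (outcome s) (outcome s')

/-- Laziness property: every node where the action changes lies along the play induced by the
new profile. -/
def Laziness (s s' : G.Profile) : Prop :=
  ∀ h : G.Inner, act s h ≠ act s' h → LiesAlong s' h.1

/-- The `{I, L}`-dynamics: updates between two distinct profiles that have the improvement and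
the laziness property. -/
def DynIL (s s' : G.Profile) : Prop :=
  s ≠ s' ∧ Improvement s s' ∧ Laziness s s'

end SeqGame

/-- A dynamics terminates if it has no infinite sequence of successive updates. -/
def Terminates {S : Type*} (r : S → S → Prop) : Prop :=
  ¬ ∃ s : ℕ → S, ∀ k, r (s k) (s (k + 1))

section Preferences

variable {N O : Type*} (pref : N → O → O → Prop)

/-- The `{I, L}`-dynamics terminates in every game built over `N`, `O` and the preferences.
The finite nonempty set of actions is arbitrary (up to renaming, it is a type in `Type`). -/
def DynILTerminatesInAllGames : Prop :=
  ∀ (A : Type) [Finite A] [Nonempty A] (G : SeqGame N A O), G.pref = pref →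
    Terminates (SeqGame.DynIL (G := G))

/-- Every game built over `N`, `O` and the preferences admits a strong Nash equilibrium. -/
def AllGamesAdmitSNE : Prop :=
  ∀ (A : Type) [Finite A] [Nonempty A] (G : SeqGame N A O), G.pref = pref →
    ∃ s : G.Profile, SeqGame.IsSNE s

/-- Incomparability. -/
def Incomp (r : O → O → Prop) (x y : O) : Prop := ¬ r x y ∧ ¬ r y x

/-- Out of main pattern: never `x <ᵢ y <ᵢ z` and `y <ⱼ z <ⱼ x`. -/
def OutOfMainPattern : Prop :=
  ∀ (x y z : O) (i j : N),
    ¬ ((pref i x y ∧ pref i y z) ∧ (pref j y z ∧ pref j z x))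

/-- Out of secondary pattern: never `w <ᵢ x <ᵢ y <ᵢ z` and `x ∼ⱼ z <ⱼ w ∼ⱼ y`. -/
def OutOfSecondaryPattern : Prop :=
  ∀ (w x y z : O) (i j : N),
    ¬ ((pref i w x ∧ pref i x y ∧ pref i y z) ∧
      (Incomp (pref j) x z ∧ pref j z w ∧ Incomp (pref j) w y))

/-- Out of pattern: out of main and of secondary pattern. -/
def OutOfPattern : Prop := OutOfMainPattern pref ∧ OutOfSecondaryPattern pref

end Preferences

/-! ### Termination gives an SNE -/

namespace SeqGame

variable {N A O : Type*} {G : SeqGame N A O}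

/-! 1 → 2: if a coalition beats `s` by a deviation `d`, then playing `d` only along the play of `d`,
and `s` elsewhere, yields the same outcome and is a lazy improvement (`exists_lazy_improvement`). So
a profile at which the dynamics stops is an SNE. 2 → 3: each forbidden pattern provides payoffs for
a three-node comb game in which every outcome is beaten by some coalition (`combGame_not_isSNE`). 3
→ 1: the core is `not_forall_dynIL_of_split`: there is no infinite run in which a set `P` of players
and its complement never move together and each side follows one strict order. Laziness freezes a
subgame while it is not being played, so whatever bad value `P` left there is what `P` finds on
coming back. Hence `eventually_not_subgameSat`: if the late moves of `P` start below a rank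
threshold, they also end below it. Lowering the threshold step by step silences `P`, and then the
other side would climb forever in a finite set. To reach such a split, note that outcomes are finite
in number, so late steps of a run can be undone by paths of steps that each please somebody
(`eventually_reflTransGen_of_finite`). For two players out of pattern, a step both prefer cannot be
undone, so late moves are unilateral. For linear orders, late outcomes stay in one class of the
equivalence relation `Conflict`, on which any two players have equal or opposite preferences
(`conflict_dichotomy`). -/

instance : Nonempty G.Profile :=
  ⟨fun _ => ⟨fun h => h.1.2.2.choose, fun h => h.1.2.2.choose_spec⟩⟩

theorem LiesAlong.of_prefix {s : G.Profile} {h h' : List A} (hs : LiesAlong s h')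
    (hp : h <+: h') : LiesAlong s h :=
  fun g a hg => hs g a (hg.trans hp)

theorem outcome_eq {s : G.Profile} {z : G.Leaf} (hz : LiesAlong s z.1) :
    outcome s = G.payoff z := by
  unfold outcome
  rw [(existsUnique_leaf s).unique (existsUnique_leaf s).choose_spec.1 hz]

theorem exists_act_ne {s s' : G.Profile} {i : N} (h : s i ≠ s' i) :
    ∃ g : G.Inner, act s g ≠ act s' g ∧ G.owner g = i := by
  by_contra! hc
  refine h (Subtype.ext (funext ?_))
  rintro ⟨g, rfl⟩
  by_contra hne
  exact hc g hne rfl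

theorem ne_of_act_ne {s s' : G.Profile} {g : G.Inner} (h : act s g ≠ act s' g) :
    s (G.owner g) ≠ s' (G.owner g) :=
  fun he => h (by unfold act; rw [he])

theorem act_deviate_of_notMem {s : G.Profile} {I : Set N} {t : ∀ i : I, G.Strategy i}
    {g : G.Inner} (hg : G.owner g ∉ I) : act (deviate s I t) g = act s g := by
  simp [act, deviate, hg]

/-- Moves of a winning deviation off its own play do not affect the outcome, so dropping them makes
the deviation lazy and keeps it profitable. -/
theorem exists_lazy_improvement {s : G.Profile} (hirr : ∀ i x, ¬ G.pref i x x)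
    (hs : ¬ IsSNE s) : ∃ s', DynIL s s' := by
  classical
  unfold IsSNE at hs
  push Not at hs
  obtain ⟨I, ⟨i₀, hi₀⟩, t, ht⟩ := hs
  set d := deviate s I t with hd
  let s' : G.Profile := fun i =>
    ⟨fun h => if LiesAlong d h.1.1 then (d i).1 h else (s i).1 h, fun h => by
      by_cases hl : LiesAlong d h.1.1
      · simpa only [hl, if_true] using (d i).2 h
      · simpa only [hl, if_false] using (s i).2 h⟩
  have hact : ∀ g : G.Inner, act s' g = if LiesAlong d g.1 then act d g else act s g :=
    fun g => rfl
  have hlies : ∀ h, LiesAlong d h → LiesAlong s' h := by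
    intro h hh g a hga
    rw [hact, if_pos (hh.of_prefix ((List.prefix_append _ _).trans hga))]
    exact hh g a hga
  obtain ⟨z, hz, -⟩ := existsUnique_leaf d
  have hout : outcome s' = outcome d := by rw [outcome_eq hz, outcome_eq (hlies _ hz)]
  refine ⟨s', fun he => ?_, fun i hi => ?_, fun g hg => ?_⟩
  · apply hirr i₀ (outcome s)
    have := ht i₀ hi₀
    rwa [← hout, ← he] at this
  · rw [hout]
    apply ht
    by_contra hiI
    apply hi
    apply Subtype.ext
    funext h
    have : d i = s i := by simp [hd, deviate, hiI]
    simp [s', this]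
  · apply hlies
    by_contra hl
    exact hg (by rw [hact, if_neg hl])

theorem exists_isSNE_of_terminates (hirr : ∀ i x, ¬ G.pref i x x)
    (hG : Terminates (DynIL (G := G))) : ∃ s : G.Profile, IsSNE s := by
  by_contra! hc
  choose f hf using fun s : G.Profile => exists_lazy_improvement hirr (hc s)
  refine hG ⟨fun k => f^[k] (Classical.arbitrary _), fun k => ?_⟩
  simpa only [Function.iterate_succ_apply'] using hf _

/-- A coalition that controls the missing moves can enforce a given terminal node. -/
theorem IsSNE.not_pref {s : G.Profile} (hs : IsSNE s) {I : Set N} (hI : I.Nonempty) (z : G.Leaf)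
    (hz : ∀ (g : G.Inner) (a : A), g.1 ++ [a] <+: z.1 → act s g = a ∨ G.owner g ∈ I) :
    ∃ i ∈ I, ¬ G.pref i (outcome s) (G.payoff z) := by
  classical
  let t : ∀ i : I, G.Strategy i := fun i =>
    ⟨fun h => if hh : ∃ a, h.1.1 ++ [a] <+: z.1 then hh.choose else (s i).1 h, fun h => by
      beta_reduce
      split_ifs with hh
      · exact G.prefix_closed _ z.2.1 _ hh.choose_spec
      · exact (s i).2 h⟩
  obtain ⟨i, hi, h⟩ := hs I hI t
  refine ⟨i, hi, ?_⟩
  rwa [← outcome_eq (s := deviate s I t) (z := z)]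
  intro g a hga
  by_cases hg : G.owner g ∈ I
  · have hh : ∃ a, g.1 ++ [a] <+: z.1 := ⟨a, hga⟩
    have h1 : act (deviate s I t) g = hh.choose := by
      simp only [act, deviate, hg, dif_pos, t]
      rw [dif_pos hh]
    rw [h1]
    have := List.prefix_of_prefix_length_le hh.choose_spec hga (by simp)
    have := this.eq_of_length (by simp)
    simpa using this
  · rw [act_deviate_of_notMem hg]
    exact (hz g a hga).resolve_right hg

end SeqGame

/-! ### Patterns yield games without SNE -/

section CombGame

/-- The nodes of a comb with three nonterminal nodes. -/
def combNodes : List (List Bool) :=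
  [[], [false], [true], [true, false], [true, true], [true, true, false], [true, true, true]]

theorem combNodes_inner : ∀ h ∈ combNodes, ∀ a, h ++ [a] ∈ combNodes →
    h = [] ∨ h = [true] ∨ h = [true, true] := by decide

theorem combNodes_prefix : ∀ h ∈ combNodes, ∀ h' ∈ h.inits, h' ∈ combNodes := by decide

variable {N O : Type*}

/-- At the root player `i` chooses between `p` and passing to `j`, who chooses between `q` and
passing to `i`, who chooses between `r` and `t`. -/
def combGame (pref : N → O → O → Prop) (i j : N) (p q r t : O) : SeqGame N Bool O where
  H := {h | h ∈ combNodes}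
  finite_H := combNodes.finite_toSet
  nil_mem := by decide
  prefix_closed h hh h' hp := combNodes_prefix h hh h' ((List.mem_inits h' h).2 hp)
  owner h := if h.1 = [true] then j else i
  payoff z := if z.1 = [false] then p else if z.1 = [true, false] then q else
    if z.1 = [true, true, false] then r else t
  pref := pref

/-- No outcome is stable: `i` and `j` jointly leave `p` for `r`, `i` leaves `q` for `p`, `j` leaves
`t` for `q`, and `r` is left by `i` for `t` or by `j` for `q`. The disjunction `hr` serves the two
patterns. -/
theorem combGame_not_isSNE {pref : N → O → O → Prop} {i j : N} {p q r t : O}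
    (hpi : pref i p r) (hpj : pref j p r) (hq : pref i q p) (hr : pref i r t ∨ pref j r q)
    (ht : pref j t q) (s : (combGame pref i j p q r t).Profile) : ¬ SeqGame.IsSNE s := by
  intro hs
  let G := combGame pref i j p q r t
  have hleaf : ∀ h ∈ combNodes, (∀ a, h ++ [a] ∉ combNodes) → h ∈ G.H ∧ ∀ a, h ++ [a] ∉ G.H :=
    fun h h1 h2 => ⟨h1, h2⟩
  let P : G.Leaf := ⟨[false], hleaf _ (by decide) (by decide)⟩
  let Q : G.Leaf := ⟨[true, false], hleaf _ (by decide) (by decide)⟩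
  let R : G.Leaf := ⟨[true, true, false], hleaf _ (by decide) (by decide)⟩
  let T : G.Leaf := ⟨[true, true, true], hleaf _ (by decide) (by decide)⟩
  let g0 : G.Inner := ⟨[], by change _ ∈ combNodes; decide, true, by change _ ∈ combNodes; decide⟩
  let g1 : G.Inner :=
    ⟨[true], by change _ ∈ combNodes; decide, true, by change _ ∈ combNodes; decide⟩
  let g2 : G.Inner :=
    ⟨[true, true], by change _ ∈ combNodes; decide, true, by change _ ∈ combNodes; decide⟩
  have hg : ∀ g : G.Inner, g = g0 ∨ g = g1 ∨ g = g2 := by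
    rintro ⟨g, h1, a, h2⟩
    simpa only [Subtype.mk.injEq, g0, g1, g2] using combNodes_inner g h1 a h2
  have o0 : G.owner g0 = i := by
    change (if ([] : List Bool) = [true] then j else i) = i
    simp
  have o1 : G.owner g1 = j := by
    change (if ([true] : List Bool) = [true] then j else i) = j
    simp
  have o2 : G.owner g2 = i := by
    change (if ([true, true] : List Bool) = [true] then j else i) = i
    simp
  have hP : G.payoff P = p := by
    change (if [false] = [false] then p else if [false] = [true, false] then q else
      if [false] = [true, true, false] then r else t) = _
    simp
  have hQ : G.payoff Q = q := by
    change (if [true, false] = [false] then p else if [true, false] = [true, false] then q else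
      if [true, false] = [true, true, false] then r else t) = _
    simp
  have hR : G.payoff R = r := by
    change (if [true, true, false] = [false] then p else if [true, true, false] = [true, false] then q else
      if [true, true, false] = [true, true, false] then r else t) = _
    simp
  have hT : G.payoff T = t := by
    change (if [true, true, true] = [false] then p else if [true, true, true] = [true, false] then q else
      if [true, true, true] = [true, true, false] then r else t) = _
    simp
  have dev : ∀ (I : Set N) (z : G.Leaf), I.Nonempty →
      (∀ (g : G.Inner) (a : Bool), g.1 ++ [a] <+: z.1 → SeqGame.act s g = a ∨ G.owner g ∈ I) →
      ¬ ∀ k ∈ I, pref k (SeqGame.outcome s) (G.payoff z) := by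
    intro I z hI hz hall
    obtain ⟨k, hk, hk'⟩ := hs.not_pref hI z hz
    exact hk' (hall k hk)
  have along : ∀ z : G.Leaf, (∀ a, [a] <+: z.1 → SeqGame.act s g0 = a) →
      (∀ a, [true, a] <+: z.1 → SeqGame.act s g1 = a) →
      (∀ a, [true, true, a] <+: z.1 → SeqGame.act s g2 = a) →
      SeqGame.outcome s = G.payoff z := by
    intro z h0 h1 h2
    refine SeqGame.outcome_eq fun g a hga => ?_
    rcases hg g with rfl | rfl | rfl
    exacts [h0 a hga, h1 a hga, h2 a hga]
  cases h0 : SeqGame.act s g0 with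
  | false =>
    have ho : SeqGame.outcome s = p := by
      rw [← hP]; apply along <;> simp [P, h0]
    refine dev {i, j} R ⟨i, by simp⟩ ?_ ?_
    · intro g a _
      rcases hg g with rfl | rfl | rfl <;> simp [o0, o1, o2]
    · rw [ho, hR]
      rintro k (rfl | rfl) <;> assumption
  | true =>
    cases h1 : SeqGame.act s g1 with
    | false =>
      have ho : SeqGame.outcome s = q := by
        rw [← hQ]; apply along <;> simp [Q, h0, h1]
      refine dev {i} P ⟨i, by simp⟩ ?_ ?_
      · intro g a hga
        rcases hg g with rfl | rfl | rfl
        · simp [o0]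
        · simp [P, g1] at hga
        · simp [o2]
      · rw [ho, hP]
        rintro k rfl; assumption
    | true =>
      have toQ : ¬ pref j (SeqGame.outcome s) q := by
        intro hj
        refine dev {j} Q ⟨j, by simp⟩ ?_ ?_
        · intro g a hga
          rcases hg g with rfl | rfl | rfl
          · left; simp [Q, g0] at hga; rw [h0, hga]
          · simp [o1]
          · simp [Q, g2] at hga
        · rw [hQ]
          rintro k rfl; assumption
      cases h2 : SeqGame.act s g2 with
      | true =>
        have ho : SeqGame.outcome s = t := by
          rw [← hT]; apply along <;> simp [T, h0, h1, h2]
        exact toQ (by rw [ho]; exact ht)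
      | false =>
        have ho : SeqGame.outcome s = r := by
          rw [← hR]; apply along <;> simp [R, h0, h1, h2]
        rcases hr with hr | hr
        · refine dev {i} T ⟨i, by simp⟩ ?_ ?_
          · intro g a hga
            rcases hg g with rfl | rfl | rfl
            · simp [o0]
            · left; simp [T, g1] at hga; rw [h1, hga]
            · simp [o2]
          · rw [ho, hT]
            rintro k rfl; assumption
        · exact toQ (by rw [ho]; exact hr)

theorem outOfPattern_of_allGamesAdmitSNE {pref : N → O → O → Prop}
    (hpref : ∀ i, IsStrictWeakOrder O (pref i)) (h : AllGamesAdmitSNE pref) :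
    OutOfPattern pref := by
  constructor
  · rintro x y z i j ⟨⟨h1, h2⟩, h3, h4⟩
    -- Equal payoffs `z` make the last choice a dummy, and `j` leaves `z` for `x`.
    obtain ⟨s, hs⟩ := h Bool (combGame pref i j y x z z) rfl
    exact combGame_not_isSNE h2 h3 h1 (Or.inr h4) h4 s hs
  · rintro w x y z i j ⟨⟨h1, h2, h3⟩, h4, h5, h6⟩
    obtain ⟨s, hs⟩ := h Bool (combGame pref i j x w y z) rfl
    refine combGame_not_isSNE h2 ?_ h1 (Or.inl h3) h5 s hs
    -- It remains to see `x <ⱼ y`, which follows from `x ∼ⱼ z <ⱼ w ∼ⱼ y` in a weak order.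
    have := hpref j
    by_contra hxy
    by_cases hyx : pref j y x
    · by_cases hzy : pref j z y
      · exact h4.2 (_root_.trans hzy hyx)
      · have hyz : Incomp (pref j) y z :=
          ⟨fun hyz => h6.2 (_root_.trans hyz h5), hzy⟩
        exact (IsStrictWeakOrder.incomp_trans w y z h6 hyz).2 h5
    · have h7 := IsStrictWeakOrder.incomp_trans z x y ⟨h4.2, h4.1⟩ ⟨hxy, hyx⟩
      exact (IsStrictWeakOrder.incomp_trans z y w h7 ⟨h6.2, h6.1⟩).1 h5

end CombGame

open Filter

/-! ### Lazy dynamics on subgames -/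

namespace SeqGame

variable {N A O : Type*} {G : SeqGame N A O}

/-- The play induced by `s` in the subgame at `h` ends in an outcome satisfying `p`. -/
def SubgameSat (p : O → Prop) (s : G.Profile) (h : List A) : Prop :=
  ∃ z : G.Leaf, h <+: z.1 ∧
    (∀ (g : G.Inner) (a : A), h <+: g.1 → g.1 ++ [a] <+: z.1 → act s g = a) ∧ p (G.payoff z)

theorem subgameSat_nil {p : O → Prop} {s : G.Profile} :
    SubgameSat p s [] ↔ p (outcome s) := by
  constructor
  · rintro ⟨z, -, hz, hp⟩
    rwa [outcome_eq fun g a hg => hz g a List.nil_prefix hg]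
  · intro hp
    obtain ⟨z, hz, -⟩ := existsUnique_leaf s
    exact ⟨z, List.nil_prefix, fun g a _ hg => hz g a hg, by rwa [← outcome_eq hz]⟩

theorem eq_of_concat_prefix {l m : List A} {a b : A} (ha : l ++ [a] <+: m)
    (hb : l ++ [b] <+: m) : a = b := by
  have := (List.prefix_of_prefix_length_le ha hb (by simp)).eq_of_length (by simp)
  simpa using this

theorem exists_concat_prefix {l m : List A} (h : l <+: m) (hne : l ≠ m) :
    ∃ a, l ++ [a] <+: m := by
  obtain ⟨t, rfl⟩ := h
  cases t with
  | nil => simp at hne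
  | cons b t => exact ⟨b, t, by simp⟩

theorem subgameSat_inner {p : O → Prop} {s : G.Profile} (h : G.Inner) :
    SubgameSat p s h.1 ↔ SubgameSat p s (h.1 ++ [act s h]) := by
  constructor
  · rintro ⟨z, hz, hs, hp⟩
    have hne : h.1 ≠ z.1 := by
      intro he
      obtain ⟨a, ha⟩ := h.2.2
      exact z.2.2 a (he ▸ ha)
    obtain ⟨a, ha⟩ := exists_concat_prefix hz hne
    have := hs h a List.prefix_rfl ha
    refine ⟨z, this ▸ ha, fun g b hg hb => hs g b ((List.prefix_append _ _).trans hg) hb, hp⟩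
  · rintro ⟨z, hz, hs, hp⟩
    refine ⟨z, (List.prefix_append _ _).trans hz, fun g b hg hb => ?_, hp⟩
    by_cases he : h.1 = g.1
    · obtain rfl : h = g := Subtype.ext he
      exact eq_of_concat_prefix hz hb
    · obtain ⟨c, hc⟩ := exists_concat_prefix hg he
      obtain rfl := eq_of_concat_prefix hz ((hc.trans (List.prefix_append _ _)).trans hb)
      exact hs g b hc hb

theorem subgameSat_congr {p : O → Prop} {s s' : G.Profile} {h : List A}
    (hs : ∀ g : G.Inner, h <+: g.1 → act s g = act s' g) :
    SubgameSat p s h ↔ SubgameSat p s' h := by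
  unfold SubgameSat
  refine exists_congr fun z => and_congr_right fun _ => and_congr_left fun _ => ?_
  exact forall_congr' fun g => forall_congr' fun a => forall_congr' fun hg => by rw [hs g hg]

/-- `s` and `s'` differ at a node of `P` in the subgame at `h`. -/
def ChangesIn (P : Set N) (s s' : G.Profile) (h : List A) : Prop :=
  ∃ g : G.Inner, h <+: g.1 ∧ act s g ≠ act s' g ∧ G.owner g ∈ P

theorem ChangesIn.of_prefix {P : Set N} {s s' : G.Profile} {h h' : List A}
    (hc : ChangesIn P s s' h') (hp : h <+: h') : ChangesIn P s s' h := by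
  obtain ⟨g, hg, hne, ho⟩ := hc
  exact ⟨g, hp.trans hg, hne, ho⟩

/-- If, along a lazy dynamics in which `P` and its complement never move together, `P` eventually
only changes its choices in the subgame at `h` when its outcome is outside of `p`, then these
changes eventually never lead into `p`. -/
theorem eventually_not_subgameSat [Finite A] {P : Set N} {p : O → Prop} {s : ℕ → G.Profile}
    (hL : ∀ k, Laziness (s k) (s (k + 1)))
    (hP : ∀ k, (∀ g, act (s k) g ≠ act (s (k + 1)) g → G.owner g ∈ P) ∨
      (∀ g, act (s k) g ≠ act (s (k + 1)) g → G.owner g ∉ P))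
    (h : List A)
    (hlow : ∀ᶠ k in atTop, ChangesIn P (s k) (s (k + 1)) h → ¬ SubgameSat p (s k) h) :
    ∀ᶠ k in atTop, ChangesIn P (s k) (s (k + 1)) h → ¬ SubgameSat p (s (k + 1)) h := by
  obtain ⟨M, hM⟩ : ∃ M, ∀ l ∈ G.H, l.length ≤ M := by
    obtain ⟨M, hM⟩ := (G.finite_H.image List.length).bddAbove
    exact ⟨M, fun l hl => hM ⟨l, hl, rfl⟩⟩
  -- `n` bounds the height of the subgame at `h`; at `n = 0` no nonterminal node extends `h`.
  obtain ⟨n, hn⟩ : ∃ n, M ≤ h.length + n := ⟨M, by omega⟩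
  induction n generalizing h with
  | zero =>
    refine Eventually.of_forall fun k => ?_
    rintro ⟨g, hg, -⟩
    obtain ⟨a, ha⟩ := g.2.2
    have h1 := hM _ ha
    have h2 := hg.length_le
    simp at h1
    omega
  | succ n ih =>
    by_cases hin : h ∈ G.H ∧ ∃ a, h ++ [a] ∈ G.H
    swap
    · refine Eventually.of_forall fun k => ?_
      rintro ⟨g, hg, -⟩
      refine absurd ⟨G.prefix_closed _ g.2.1 _ hg, ?_⟩ hin
      obtain ⟨b, hb⟩ := g.2.2
      obtain ⟨a, ha⟩ := exists_concat_prefix (hg.trans (List.prefix_append g.1 [b]))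
        (fun he => by have := hg.length_le; rw [he] at this; simp at this)
      exact ⟨a, G.prefix_closed _ hb _ ha⟩
    let r : G.Inner := ⟨h, hin⟩
    -- changes below a child only occur when the new play goes through this child
    have hchild : ∀ k a g, h ++ [a] <+: g.1 → act (s k) g ≠ act (s (k + 1)) g →
        act (s (k + 1)) r = a := fun k a g hg hne => hL k g hne r a hg
    have hfrozen : ∀ k a, act (s (k + 1)) r ≠ a →
        (SubgameSat p (s k) (h ++ [a]) ↔ SubgameSat p (s (k + 1)) (h ++ [a])) :=
      fun k a ha => subgameSat_congr fun g hg => by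
        by_contra hne
        exact ha (hchild k a g hg hne)
    have hval : ∀ k, SubgameSat p (s k) h ↔ SubgameSat p (s k) (h ++ [act (s k) r]) :=
      fun k => subgameSat_inner r
    have hroot : ∀ k, act (s k) r ≠ act (s (k + 1)) r → G.owner r ∈ P →
        ChangesIn P (s k) (s (k + 1)) h := fun k hne ho => ⟨r, List.prefix_rfl, hne, ho⟩
    obtain ⟨K, hK⟩ := eventually_atTop.1 hlow
    -- players in `P` only leave, hence only re-enter, children whose outcome is outside of `p`
    have hleft : ∀ a, ∀ᶠ k in atTop, G.owner r ∈ P → act (s k) r ≠ a →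
        act (s (k + 1)) r = a → ¬ SubgameSat p (s k) (h ++ [a]) := by
      intro a
      by_cases hex : ∃ k ≥ K, act (s k) r = a
      · obtain ⟨k₀, hk₀, ha⟩ := hex
        refine eventually_atTop.2 ⟨k₀, fun k hk ho hne hnew => ?_⟩
        -- Invariant from the first visit on: the child is either being played, or was left by `P`
        -- with an outcome outside `p` and has been frozen since.
        have key : act (s k) r = a ∨ ¬ SubgameSat p (s k) (h ++ [a]) := by
          clear hne hnew
          induction k, hk using Nat.le_induction with
          | base => exact Or.inl ha
          | succ k hk ihk =>
            by_cases hnew : act (s (k + 1)) r = a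
            · exact Or.inl hnew
            refine Or.inr ?_
            rw [← hfrozen k a hnew]
            by_cases hold : act (s k) r = a
            · have := hK k (hk₀.trans hk) (hroot k (by rw [hold]; exact Ne.symm hnew) ho)
              rwa [hval, hold] at this
            · exact ihk.resolve_left hold
        exact key.resolve_left hne
      -- A child not chosen from time `K` on is never entered: entering at step `k` would make it
      -- the choice at time `k + 1`.
      · push Not at hex
        exact eventually_atTop.2 ⟨K, fun k hk _ _ h2 => absurd h2 (hex (k + 1) (by omega))⟩
    have hsub : ∀ a, ∀ᶠ k in atTop, ChangesIn P (s k) (s (k + 1)) (h ++ [a]) →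
        ¬ SubgameSat p (s (k + 1)) (h ++ [a]) := by
      intro a
      refine ih (h ++ [a]) ?_ (by simp; omega)
      -- The induction hypothesis needs the child's old outcome outside `p`. If the child was
      -- already played, its outcome is that of `h`. Otherwise the root switched in the same move;
      -- this switch is due to `P`, as the two sides never move together, and `hleft` applies.
      filter_upwards [hlow, hleft a] with k hk1 hk2 hc
      have hlowk := hk1 (hc.of_prefix (List.prefix_append _ _))
      obtain ⟨g, hg, hne, ho⟩ := hc
      have hnew := hchild k a g hg hne
      by_cases hold : act (s k) r = a
      · rwa [hval, hold] at hlowk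
      · refine hk2 ?_ hold hnew
        exact ((hP k).resolve_right fun hn => hn g hne ho) r (by rw [hnew]; exact hold)
    filter_upwards [hlow, eventually_all.2 hleft, eventually_all.2 hsub] with k hk1 hk2 hk3 hc
    have hlowk := hk1 hc
    rw [hval]
    -- Either `P` moves inside the newly played child, or that child is unchanged and its outcome is
    -- known from before the move.
    by_cases hdeep : ChangesIn P (s k) (s (k + 1)) (h ++ [act (s (k + 1)) r])
    · exact hk3 _ hdeep
    have honly : ∀ g, act (s k) g ≠ act (s (k + 1)) g → G.owner g ∈ P := by
      obtain ⟨g, hg, hne, ho⟩ := hc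
      exact (hP k).resolve_right fun hn => hn g hne ho
    have hsame : ∀ g : G.Inner, h ++ [act (s (k + 1)) r] <+: g.1 →
        act (s k) g = act (s (k + 1)) g := by
      intro g hg
      by_contra hne
      exact hdeep ⟨g, hg, hne, honly g hne⟩
    rw [← subgameSat_congr hsame]
    by_cases hr : act (s k) r = act (s (k + 1)) r
    · rwa [hval, hr] at hlowk
    · exact hk2 _ (honly r hr) hr rfl

/-- In a lazy dynamics where `P` and its complement never move together and `P` only moves to
increase a bounded rank, `P` eventually stops moving. -/
theorem eventually_not_changesIn [Finite A] {P : Set N} {ρ : O → ℕ} {B : ℕ} (hB : ∀ x, ρ x ≤ B)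
    {s : ℕ → G.Profile} (hL : ∀ k, Laziness (s k) (s (k + 1)))
    (hP : ∀ k, (∀ g, act (s k) g ≠ act (s (k + 1)) g → G.owner g ∈ P) ∨
      (∀ g, act (s k) g ≠ act (s (k + 1)) g → G.owner g ∉ P))
    (hρ : ∀ k, ChangesIn P (s k) (s (k + 1)) [] → ρ (outcome (s k)) < ρ (outcome (s (k + 1)))) :
    ∀ᶠ k in atTop, ¬ ChangesIn P (s k) (s (k + 1)) [] := by
  have key : ∀ n, ∀ᶠ k in atTop, ChangesIn P (s k) (s (k + 1)) [] →
      ρ (outcome (s (k + 1))) + n ≤ B := by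
    intro n
    induction n with
    | zero => exact Eventually.of_forall fun k _ => hB _
    | succ n ih =>
      -- A move of `P` ends at rank at most `B - n` and raises the rank, so it starts strictly
      -- below; by the lemma it eventually also ends strictly below.
      have := eventually_not_subgameSat (p := fun x => B ≤ ρ x + n) hL hP [] (by
        filter_upwards [ih] with k hk hc
        rw [subgameSat_nil]
        have := hk hc
        have := hρ k hc
        omega)
      filter_upwards [this] with k hk hc
      have := hk hc
      rw [subgameSat_nil] at this
      omega
  filter_upwards [key (B + 1)] with k hk hc
  have := hk hc
  omega

/-- An infinite `{I, L}`-dynamics cannot split into moves of a coalition `P` and moves of its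
complement that are improvements for two strict orders. -/
theorem not_forall_dynIL_of_split [Finite A] [Finite O] {P : Set N} {r₁ r₂ : O → O → Prop}
    [IsStrictOrder O r₁] [IsStrictOrder O r₂] {s : ℕ → G.Profile}
    (hs : ∀ k, DynIL (s k) (s (k + 1)))
    (h₁ : ∀ k, ∀ i ∈ P, s k i ≠ s (k + 1) i → r₁ (outcome (s k)) (outcome (s (k + 1))))
    (h₂ : ∀ k, ∀ i ∉ P, s k i ≠ s (k + 1) i → r₂ (outcome (s k)) (outcome (s (k + 1))))
    (h₁₂ : ∀ k, ∀ i ∈ P, ∀ j ∉ P, s k i ≠ s (k + 1) i → s k j = s (k + 1) j) : False := by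
  -- The rank of `x` is the number of outcomes `r₁`-below it.
  have hev := eventually_not_changesIn (P := P) (ρ := fun x => {y | r₁ y x}.ncard)
    (B := Nat.card O) (fun x => Set.ncard_le_card _) (s := s) (fun k => (hs k).2.2)
    (fun k => by
      by_cases hk : ∃ i ∈ P, s k i ≠ s (k + 1) i
      · obtain ⟨i, hi, hne⟩ := hk
        left
        intro g hg
        by_contra ho
        exact ne_of_act_ne hg (h₁₂ k i hi _ ho hne)
      · right
        intro g hg ho
        exact hk ⟨_, ho, ne_of_act_ne hg⟩)
    (fun k => by
      rintro ⟨g, -, hg, ho⟩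
      have hr := h₁ k _ ho (ne_of_act_ne hg)
      refine Set.ncard_lt_ncard ⟨fun y hy => _root_.trans hy hr, fun hsub => ?_⟩ (Set.toFinite _)
      exact irrefl _ (hsub hr))
  obtain ⟨K, hK⟩ := eventually_atTop.1 hev
  have hr : ∀ k, r₂ (outcome (s (K + k))) (outcome (s (K + (k + 1)))) := by
    intro k
    have hne := (hs (K + k)).1
    obtain ⟨i, hi⟩ := Function.ne_iff.1 hne
    refine h₂ _ i (fun hiP => ?_) hi
    obtain ⟨g, hg, ho⟩ := exists_act_ne hi
    exact hK (K + k) (by omega) ⟨g, List.nil_prefix, hg, by rwa [ho]⟩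
  have hinj : ∀ m n, m < n → r₂ (outcome (s (K + m))) (outcome (s (K + n))) := by
    intro m n hmn
    induction n, hmn using Nat.le_induction with
    | base => exact hr m
    | succ n _ ih => exact _root_.trans ih (hr n)
  obtain ⟨m, n, hmn, he⟩ := Finite.exists_ne_map_eq_of_infinite fun k => outcome (s (K + k))
  rcases lt_or_gt_of_ne hmn with h | h
  · exact irrefl _ (he ▸ hinj m n h)
  · exact irrefl _ (he ▸ hinj n m h)

end SeqGame

/-- In a finite type, an infinite sequence of steps eventually only makes steps that can be
reversed by a path. -/
theorem eventually_reflTransGen_of_finite {α : Type*} [Finite α] {r : α → α → Prop} {f : ℕ → α}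
    (hf : ∀ k, r (f k) (f (k + 1))) :
    ∀ᶠ k in atTop, Relation.ReflTransGen r (f (k + 1)) (f k) := by
  -- By finiteness, from some time on only values taken infinitely often occur, so each late `f k`
  -- is met again.
  have h1 : ∀ x, ∀ᶠ k in atTop, f k = x → ∃ᶠ m in atTop, f m = x := by
    intro x
    by_cases hx : ∃ᶠ m in atTop, f m = x
    · exact Eventually.of_forall fun _ _ => hx
    · filter_upwards [not_frequently.1 hx] with k hk hk'
      exact absurd hk' hk
  filter_upwards [eventually_all.2 h1] with k hk
  obtain ⟨m, hm, he⟩ := frequently_atTop.1 (hk (f k) rfl) (k + 1)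
  rw [← he]
  clear he
  induction m, hm using Nat.le_induction with
  | base => exact .refl
  | succ m _ ih => exact ih.tail (hf m)

/-! ### Two weak orders out of pattern -/

section TwoPlayers

variable {O : Type*} {r : O → O → Prop}

/-- Counting the elements below works because incomparable elements of a weak order have the same
predecessors. Ranks turn the pattern arguments into linear arithmetic. -/
theorem exists_rank [Finite O] [IsStrictWeakOrder O r] :
    ∃ ρ : O → ℕ, ∀ x y, r x y ↔ ρ x < ρ y := by
  refine ⟨fun x => {y | r y x}.ncard, fun x y => ⟨fun h => ?_, fun h => ?_⟩⟩
  · exact Set.ncard_lt_ncard ⟨fun z hz => _root_.trans (show r z x from hz) h,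
      fun hsub => irrefl _ (hsub h)⟩ (Set.toFinite _)
  · by_contra hxy
    refine h.not_ge (Set.ncard_le_ncard (fun z (hz : r z y) => ?_) (Set.toFinite _))
    by_contra hzx
    by_cases hxz : r x z
    · exact hxy (_root_.trans hxz hz)
    by_cases hyx : r y x
    · exact hzx (_root_.trans hz hyx)
    exact (IsStrictWeakOrder.incomp_trans z x y ⟨hzx, hxz⟩ ⟨hxy, hyx⟩).1 hz

variable {a b : O → ℕ}

/-- With two players and out of main pattern, paths of individually preferred steps shorten to at
most three steps. -/
theorem exists_short_path
    (hab : ∀ x y z, ¬ ((a x < a y ∧ a y < a z) ∧ (b y < b z ∧ b z < b x)))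
    (hba : ∀ x y z, ¬ ((b x < b y ∧ b y < b z) ∧ (a y < a z ∧ a z < a x)))
    {x y : O} (h : Relation.ReflTransGen (fun x y => a x < a y ∨ b x < b y) x y) :
    x = y ∨ (a x < a y ∨ b x < b y) ∨
      (∃ u, (a x < a u ∨ b x < b u) ∧ (a u < a y ∨ b u < b y)) ∨
      ∃ u v, (a x < a u ∨ b x < b u) ∧ (a u < a v ∨ b u < b v) ∧ (a v < a y ∨ b v < b y) := by
  induction h with
  | refl => exact Or.inl rfl
  | @tail t w _ h ih =>
    rcases ih with rfl | ih | ⟨u, hu, ih⟩ | ⟨u, v, hu, hv, ih⟩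
    · exact Or.inr (Or.inl h)
    · exact Or.inr (Or.inr (Or.inl ⟨_, ih, h⟩))
    · exact Or.inr (Or.inr (Or.inr ⟨_, _, hu, ih, h⟩))
    · by_cases h1 : a x < a v ∨ b x < b v
      · exact Or.inr (Or.inr (Or.inr ⟨_, _, h1, ih, h⟩))
      by_cases h2 : a x < a t ∨ b x < b t
      · exact Or.inr (Or.inr (Or.inl ⟨_, h2, h⟩))
      by_cases h3 : a u < a t ∨ b u < b t
      · exact Or.inr (Or.inr (Or.inr ⟨_, _, hu, h3, h⟩))
      by_cases h4 : a u < a w ∨ b u < b w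
      · exact Or.inr (Or.inr (Or.inl ⟨_, hu, h4⟩))
      by_cases h5 : a v < a w ∨ b v < b w
      · exact Or.inr (Or.inr (Or.inr ⟨_, _, hu, hv, h5⟩))
      -- Without a shortcut, one coordinate orders `v < t < u` and the other `t < u < v`, the main
      -- pattern; the outer steps `x → u` and `t → w` make the inequalities between `t` and `u`
      -- strict.
      exfalso
      have := hab v t u
      have := hba v t u
      omega

/-- With two players and out of pattern, a step that both players prefer cannot be reversed. -/
theorem not_reflTransGen_of_lt_of_lt
    (hab : ∀ x y z, ¬ ((a x < a y ∧ a y < a z) ∧ (b y < b z ∧ b z < b x)))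
    (hba : ∀ x y z, ¬ ((b x < b y ∧ b y < b z) ∧ (a y < a z ∧ a z < a x)))
    (hab' : ∀ w x y z, ¬ ((a w < a x ∧ a x < a y ∧ a y < a z) ∧
      (b x = b z ∧ b z < b w ∧ b w = b y)))
    (hba' : ∀ w x y z, ¬ ((b w < b x ∧ b x < b y ∧ b y < b z) ∧
      (a x = a z ∧ a z < a w ∧ a w = a y)))
    {y z : O} (ha : a y < a z) (hb : b y < b z) :
    ¬ Relation.ReflTransGen (fun x y => a x < a y ∨ b x < b y) z y := by
  intro h
  have two : ∀ p, (a z < a p ∨ b z < b p) → (a p < a y ∨ b p < b y) → False := by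
    intro p h1 h2
    have := hab p y z
    have := hba p y z
    omega
  rcases exists_short_path hab hba h with rfl | h | ⟨u, hu, h⟩ | ⟨p, q, hp, hq, h⟩
  · omega
  · omega
  · exact two u hu h
  -- Up to exchanging `a` and `b`, the missing shortcuts force `a q < a y < a z < a p` and `b y ≤ b
  -- p < b q ≤ b z`. A strict outer inequality gives the main pattern, two equalities the secondary
  -- one.
  · have h1 : ¬ (a z < a q ∨ b z < b q) := fun hz => two q hz h
    have h2 : ¬ (a p < a y ∨ b p < b y) := fun hz => two p hp hz
    have := hab p q z
    have := hba p q z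
    have := hab q y p
    have := hba q y p
    have := hab' q y z p
    have := hba' q y z p
    omega

end TwoPlayers

/-! ### Linear orders out of main pattern: conflict classes -/

section Linear

variable {N O : Type*} {pref : N → O → O → Prop}

/-- The players do not agree on how to compare `x` and `y`, or `x = y`. -/
def Conflict (pref : N → O → O → Prop) (x y : O) : Prop :=
  x = y ∨ (∃ i, pref i x y) ∧ ∃ i, pref i y x

theorem Conflict.symm {x y : O} (h : Conflict pref x y) : Conflict pref y x := by
  rcases h with rfl | ⟨h1, h2⟩
  exacts [Or.inl rfl, Or.inr ⟨h2, h1⟩]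

theorem Conflict.eq_or_forall (hlin : ∀ i, IsStrictTotalOrder O (pref i)) {x y : O}
    (h : ¬ Conflict pref x y) :
    (∀ i, pref i x y) ∨ ∀ i, pref i y x := by
  unfold Conflict at h
  push Not at h
  have htri := fun i => have := hlin i; trichotomous_of (pref i) x y
  by_cases hx : ∃ i, pref i x y
  · left
    intro i
    have := h.2 hx i
    have := htri i
    tauto
  · right
    push Not at hx
    intro i
    have := hx i
    have := htri i
    tauto

/-- Some player has `y < x < z` and some player has `x < z < y`, which is the main pattern. This is
what makes `Conflict` transitive. -/
theorem Conflict.not_of_forall (hlin : ∀ i, IsStrictTotalOrder O (pref i))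
    (hmain : OutOfMainPattern pref) {x y z : O} (hxy : Conflict pref x y) (hyz : Conflict pref y z)
    (hxz : ∀ i, pref i x z) [Nonempty N] : False := by
  have hirr : ∀ i x, ¬ pref i x x := fun i x => have := hlin i; irrefl x
  have hasymm : ∀ i x y, pref i x y → ¬ pref i y x := fun i x y => have := hlin i; asymm
  have htrans : ∀ i x y z, pref i x y → pref i y z → pref i x z :=
    fun i x y z h h' => have := hlin i; _root_.trans h h'
  have i₀ := Classical.arbitrary N
  rcases hxy with rfl | ⟨-, i, hi⟩
  · rcases hyz with rfl | ⟨-, i, hi⟩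
    · exact hirr i₀ _ (hxz i₀)
    · exact hasymm i _ _ hi (hxz i)
  · rcases hyz with rfl | ⟨-, j, hj⟩
    · exact hasymm i _ _ hi (hxz i)
    · exact hmain y x z i j ⟨⟨hi, hxz i⟩, hxz j, hj⟩

theorem Conflict.trans (hlin : ∀ i, IsStrictTotalOrder O (pref i))
    (hmain : OutOfMainPattern pref) [Nonempty N] {x y z : O} (hxy : Conflict pref x y)
    (hyz : Conflict pref y z) : Conflict pref x z := by
  by_contra hxz
  rcases Conflict.eq_or_forall hlin hxz with h | h
  · exact Conflict.not_of_forall hlin hmain hxy hyz h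
  · exact Conflict.not_of_forall hlin hmain hyz.symm hxy.symm h

/-- Steps preferred by some player never return below a step preferred by everyone. -/
theorem conflict_of_reflTransGen (hlin : ∀ i, IsStrictTotalOrder O (pref i))
    (hmain : OutOfMainPattern pref) [Nonempty N] {x y : O} (hxy : ∃ i, pref i x y)
    (h : Relation.ReflTransGen (fun x y => ∃ i, pref i x y) y x) : Conflict pref x y := by
  by_contra hc
  have htrans : ∀ i x y z, pref i x y → pref i y z → pref i x z :=
    fun i x y z h h' => have := hlin i; _root_.trans h h'
  have hasymm : ∀ i x y, pref i x y → ¬ pref i y x := fun i x y => have := hlin i; asymm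
  have hirr : ∀ i x, ¬ pref i x x := fun i x => have := hlin i; irrefl x
  have hall : ∀ i, pref i x y := by
    refine (Conflict.eq_or_forall hlin hc).resolve_right fun h' => ?_
    obtain ⟨i, hi⟩ := hxy
    exact hasymm i _ _ hi (h' i)
  -- Everything reachable from `y` stays unanimously above `x`, so `x` itself is not reachable.
  have key : ∀ z, Relation.ReflTransGen (fun x y => ∃ i, pref i x y) y z →
      ∀ i, pref i x z := by
    intro z hz
    induction hz with
    | refl => exact hall
    | @tail p q _ hpq ih =>
      by_cases hcpq : Conflict pref p q
      -- `q` in conflict with `x` would link `p` to `x` by conflicts, and `q` unanimously below `x`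
      -- would be unanimously below `p`.
      · by_cases hcxq : Conflict pref x q
        · exact (Conflict.not_of_forall hlin hmain hcxq hcpq.symm ih).elim
        · refine (Conflict.eq_or_forall hlin hcxq).resolve_right fun h' => ?_
          exact Conflict.not_of_forall hlin hmain hcpq.symm (Or.inl rfl)
            fun i => htrans i _ _ _ (h' i) (ih i)
      · intro i
        refine htrans i _ _ _ (ih i) ?_
        refine (Conflict.eq_or_forall hlin hcpq).resolve_right (fun h' => ?_) i
        obtain ⟨j, hj⟩ := hpq
        exact hasymm j _ _ hj (h' j)
  exact hirr (Classical.arbitrary N) x (key x h _)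

/-- Two players that agree on `x` and `y` also agree on `x` and `z`, for `x`, `y` in conflict. -/
theorem pref_iff_of_conflict (hlin : ∀ i, IsStrictTotalOrder O (pref i))
    (hmain : OutOfMainPattern pref) {x y z : O} {i j : N} (hxy : Conflict pref x y)
    (hne : x ≠ y) (hag : pref i x y ↔ pref j x y) : pref i x z ↔ pref j x z := by
  have hirr : ∀ i x, ¬ pref i x x := fun i x => have := hlin i; irrefl x
  have hasymm : ∀ i x y, pref i x y → ¬ pref i y x := fun i x y => have := hlin i; asymm
  have htrans : ∀ i x y z, pref i x y → pref i y z → pref i x z :=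
    fun i x y z h h' => have := hlin i; _root_.trans h h'
  have htri := fun i x y => have := hlin i; trichotomous_of (pref i) x y
  unfold OutOfMainPattern at hmain
  obtain ⟨⟨k, hk⟩, l, hl⟩ := hxy.resolve_left hne
  -- Out of main pattern, no two players order three outcomes by different rotations of the same
  -- cycle, so at most two orders of `x`, `y`, `z` occur. If `i` and `j` differed on `x`, `z`, their
  -- orders and that of a player opposing them on `x`, `y` would be three.
  by_cases h : pref i x y
  · grind
  · grind

/-- One pair of distinct outcomes on which `i` and `j` agree spreads to the whole class: replace the
endpoints one at a time by `pref_iff_of_conflict`. -/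
theorem conflict_dichotomy (hlin : ∀ i, IsStrictTotalOrder O (pref i))
    (hmain : OutOfMainPattern pref) [Nonempty N] {c : O} {i j : N} :
    (∀ x y, Conflict pref c x → Conflict pref c y → (pref i x y ↔ pref j x y)) ∨
      ∀ x y, Conflict pref c x → Conflict pref c y → (pref i x y ↔ pref j y x) := by
  have hasymm : ∀ i x y, pref i x y → ¬ pref i y x := fun i x y => have := hlin i; asymm
  have htri := fun i x y => have := hlin i; trichotomous_of (pref i) x y
  have hirr : ∀ i x, ¬ pref i x x := fun i x => have := hlin i; irrefl x
  have hflip : ∀ x y, x ≠ y → (pref i x y ↔ pref j x y) → (pref i y x ↔ pref j y x) := by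
    grind
  by_cases hex : ∃ x y, Conflict pref c x ∧ Conflict pref c y ∧ x ≠ y ∧
      (pref i x y ↔ pref j x y)
  · left
    obtain ⟨x, y, hx, hy, hne, hag⟩ := hex
    have hstep : ∀ z, pref i x z ↔ pref j x z := fun z =>
      pref_iff_of_conflict hlin hmain (Conflict.trans hlin hmain hx.symm hy) hne hag
    intro u v hu _
    by_cases hux : x = u
    · exact hux ▸ hstep v
    · exact pref_iff_of_conflict hlin hmain (Conflict.trans hlin hmain hu.symm hx)
        (Ne.symm hux) (hflip x u hux (hstep u))
  · right
    push Not at hex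
    intro u v hu hv
    by_cases huv : u = v
    · subst huv; simp [hirr]
    · have := hex u v hu hv huv
      grind

end Linear

/-! ### Termination and the equivalence -/

section Termination

variable {N O : Type*} [Finite O] {pref : N → O → O → Prop}

/-- Late steps can be undone by a path, while steps that both players prefer cannot; so late moves
are unilateral and split between `{i}` and `{j}`. -/
theorem terminates_of_two_players (hN : Nat.card N = 2)
    (hweak : ∀ i, IsStrictWeakOrder O (pref i)) (hout : OutOfPattern pref) :
    DynILTerminatesInAllGames pref := by
  rintro A _ _ G rfl ⟨s, hs⟩
  obtain ⟨i, j, hij, huniv⟩ := Nat.card_eq_two_iff.1 hN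
  have hij' : ∀ k, k = i ∨ k = j := fun k => by
    have : k ∈ ({i, j} : Set N) := huniv ▸ Set.mem_univ k
    simpa using this
  have := hweak i
  have := hweak j
  obtain ⟨a, ha⟩ := exists_rank (r := G.pref i)
  obtain ⟨b, hb⟩ := exists_rank (r := G.pref j)
  obtain ⟨hm, hsec⟩ := hout
  have hstep : ∀ k, a (SeqGame.outcome (s k)) < a (SeqGame.outcome (s (k + 1))) ∨
      b (SeqGame.outcome (s k)) < b (SeqGame.outcome (s (k + 1))) := by
    intro k
    obtain ⟨l, hl⟩ := Function.ne_iff.1 (hs k).1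
    have himp := (hs k).2.1 l hl
    rcases hij' l with rfl | rfl
    · exact Or.inl ((ha _ _).1 himp)
    · exact Or.inr ((hb _ _).1 himp)
  obtain ⟨K, hK⟩ := eventually_atTop.1 (eventually_reflTransGen_of_finite
    (r := fun x y => a x < a y ∨ b x < b y) (f := fun k => SeqGame.outcome (s k)) hstep)
  refine SeqGame.not_forall_dynIL_of_split (P := {i}) (r₁ := G.pref i) (r₂ := G.pref j)
    (s := fun k => s (K + k)) (fun k => hs _) ?_ ?_ ?_
  · rintro k _ rfl hne
    exact (hs _).2.1 _ hne
  · intro k l hl hne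
    obtain rfl : l = j := (hij' l).resolve_left hl
    exact (hs _).2.1 _ hne
  · intro k m hm' l hl hne
    obtain rfl : i = m := (Set.mem_singleton_iff.1 hm').symm
    obtain rfl : l = j := (hij' l).resolve_left hl
    by_contra hne'
    refine not_reflTransGen_of_lt_of_lt (a := a) (b := b) ?_ ?_ ?_ ?_
      ((ha _ _).1 ((hs _).2.1 _ hne)) ((hb _ _).1 ((hs _).2.1 _ hne')) (hK (K + k) (by omega))
    · intro x y z
      simpa only [ha, hb] using hm x y z i l
    · intro x y z
      simpa only [ha, hb] using hm x y z l i
    · intro w x y z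
      have := hsec w x y z i l
      simp only [Incomp, ha, hb] at this
      omega
    · intro w x y z
      have := hsec w x y z l i
      simp only [Incomp, ha, hb] at this
      omega

/-- Late outcomes stay in the conflict class of `c`, where each player follows the order of a
reference player `i₀` or its reverse. A joint move of the two camps would go both up and down that
order. -/
theorem terminates_of_linear [Nonempty N] (hlin : ∀ i, IsStrictTotalOrder O (pref i))
    (hmain : OutOfMainPattern pref) : DynILTerminatesInAllGames pref := by
  rintro A _ _ G rfl ⟨s, hs⟩
  have hstep : ∀ k, ∃ i, G.pref i (SeqGame.outcome (s k)) (SeqGame.outcome (s (k + 1))) := by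
    intro k
    obtain ⟨l, hl⟩ := Function.ne_iff.1 (hs k).1
    exact ⟨l, (hs k).2.1 l hl⟩
  obtain ⟨K, hK⟩ := eventually_atTop.1 (eventually_reflTransGen_of_finite
    (r := fun x y => ∃ i, G.pref i x y) (f := fun k => SeqGame.outcome (s k)) hstep)
  have hcls : ∀ k, Conflict G.pref (SeqGame.outcome (s K)) (SeqGame.outcome (s (K + k))) := by
    intro k
    induction k with
    | zero => exact Or.inl rfl
    | succ k ih =>
      exact Conflict.trans hlin hmain ih
        (conflict_of_reflTransGen hlin hmain (hstep _) (hK (K + k) (by omega)))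
  set c := SeqGame.outcome (s K)
  have i₀ := Classical.arbitrary N
  have := hlin i₀
  have hswap : IsStrictOrder O (Function.swap (G.pref i₀)) := inferInstance
  let P : Set N := {i | ∀ x y, Conflict G.pref c x → Conflict G.pref c y →
    (G.pref i x y ↔ G.pref i₀ x y)}
  have h1 : ∀ k, ∀ i ∈ P, s (K + k) i ≠ s (K + (k + 1)) i →
      G.pref i₀ (SeqGame.outcome (s (K + k))) (SeqGame.outcome (s (K + (k + 1)))) :=
    fun k i hi hne => (hi _ _ (hcls _) (hcls _)).1 ((hs _).2.1 i hne)
  have h2 : ∀ k, ∀ i ∉ P, s (K + k) i ≠ s (K + (k + 1)) i →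
      G.pref i₀ (SeqGame.outcome (s (K + (k + 1)))) (SeqGame.outcome (s (K + k))) :=
    fun k i hi hne => (((conflict_dichotomy hlin hmain).resolve_left hi) _ _ (hcls _) (hcls _)).1
      ((hs _).2.1 i hne)
  refine SeqGame.not_forall_dynIL_of_split (P := P) (r₁ := G.pref i₀)
    (r₂ := Function.swap (G.pref i₀)) (s := fun k => s (K + k)) (fun k => hs _) h1 h2 ?_
  intro k i hi j hj hne
  by_contra hne'
  exact asymm (h1 k i hi hne) (h2 k j hj hne')

end Termination

theorem mainTheorem3 {N O : Type*} [Finite N] [Nonempty N] [Finite O] [Nonempty O]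
    (pref : N → O → O → Prop)
    (hpref : (Nat.card N = 2 ∧ ∀ i, IsStrictWeakOrder O (pref i)) ∨
      (∀ i, IsStrictTotalOrder O (pref i))) :
    List.TFAE [DynILTerminatesInAllGames pref, AllGamesAdmitSNE pref, OutOfPattern pref] := by
  have hweak : ∀ i, IsStrictWeakOrder O (pref i) := by
    rcases hpref with ⟨-, h⟩ | h
    · exact h
    · refine fun i => have := h i; { incomp_trans := fun x y z hxy hyz => ?_ }
      obtain rfl := Std.Trichotomous.trichotomous x y hxy.1 hxy.2
      exact hyz
  tfae_have 1 → 2 := by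
    rintro h A _ _ G rfl
    exact SeqGame.exists_isSNE_of_terminates (fun i x => have := hweak i; irrefl x) (h A G rfl)
  tfae_have 2 → 3 := outOfPattern_of_allGamesAdmitSNE hweak
  tfae_have 3 → 1 := by
    intro h
    rcases hpref with ⟨hN, hw⟩ | hl
    · exact terminates_of_two_players hN hw h
    -- The secondary pattern cannot occur here: `x ∼ⱼ z` would mean `x = z`.
    · exact terminates_of_linear hl h.1
  tfae_finish
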